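/- **Theorem.** *Tense formulas* are built from countably many variables $p_0,p_1,\dots$ by $\bot$, $\to$ and the unary operators $\Box$ (future necessity) and $\blacklozenge$ (past possibility). A *tense logic* is a set $L$ of tense formulas that contains all classical tautologies, is closed under modus ponens and under uniform substitution, and satisfies $\blacklozenge\varphi\to\psi\in L\iff\varphi\to\Box\psi\in L$ for all $\varphi,\psi$. Let $\mathsf{K4}_t$ be the least tense logic containing $\Box p\to\Box\Box p$, and let $\mathsf{NExt}(\mathsf{K4}_t)$ be the set of all tense logics that contain $\mathsf{K4}_t$. A *frame* is a pair $(X,R)$ with $X$ a nonempty set and $R\subseteq X\times X$. A valuation $V$ assigns a subset of $X$ to each variable; the Boolean connectives are interpreted as usual, $V(\Box\varphi)=\{x: \forall y\,(Rxy\Rightarrow y\in V(\varphi))\}$ and $V(\blacklozenge\varphi)=\{x:\exists y\,(Ryx\text{ and }y\in V(\varphi))\}$. A formula $\varphi$ is valid in $(X,R)$ if $V(\varphi)=X$ for all valuations $V$. Let $\mathsf{Fr}(L)$ (respectively $\mathsf{Fin}(L)$) be the class of all frames (respectively all finite frames) in which every formula of $L$ is valid. For $L\in\mathsf{NExt}(\mathsf{K4}_t)$,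 the *degree of Kripke-incompleteness* and the *degree of the finite model property* of $L$ in $\mathsf{NExt}(\mathsf{K4}_t)$ are the cardinals $$\mathsf{deg}(L)=|\{L'\in\mathsf{NExt}(\mathsf{K4}_t):\mathsf{Fr}(L')=\mathsf{Fr}(L)\}|,\qquad \mathsf{df}(L)=|\{L'\in\mathsf{NExt}(\mathsf{K4}_t):\mathsf{Fin}(L')=\mathsf{Fin}(L)\}|.$$ Then for every $L\in\mathsf{NExt}(\mathsf{K4}_t)$, $$\mathsf{deg}(L)=\mathsf{df}(L)\in\{1,2^{\aleph_0}\}.$$ -/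

import Mathlib

universe u

namespace Tense

/-- Formulas of the language of tense logic over the variables `p 0, p 1, …`. -/
inductive Formula : Type
  | var : ℕ → Formula
  | bot : Formula
  | imp : Formula → Formula → Formula
  | box : Formula → Formula
  | bdia : Formula → Formula

namespace Formula

/-- The homomorphism of the formula algebra that extends `s : ℕ → Formula`. -/
def subst (s : ℕ → Formula) : Formula → Formula
  | var n => s n
  | bot => bot
  | imp φ ψ => imp (subst s φ) (subst s ψ)
  | box φ => box (subst s φ)
  | bdia φ => bdia (subst s φ)

/-- `φ` is (a substitution instance of) a classical propositional tautology: it is true under every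
assignment of truth values to formulas that treats `⊥` and `→` classically (variables and formulas
that begin with a tense operator get arbitrary values). -/
def IsTautology (φ : Formula) : Prop :=
  ∀ v : Formula → Prop, ¬ v bot → (∀ α β, v (imp α β) ↔ (v α → v β)) → v φ

end Formula

/-- Tense logics, as sets of formulas. -/
structure IsTenseLogic (L : Set Formula) : Prop where
  taut : ∀ φ : Formula, φ.IsTautology → φ ∈ L
  residuation : ∀ φ ψ : Formula,
    Formula.imp (Formula.bdia φ) ψ ∈ L ↔ Formula.imp φ (Formula.box ψ) ∈ L
  mp : ∀ φ ψ : Formula, φ ∈ L → Formula.imp φ ψ ∈ L → ψ ∈ L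
  subst : ∀ (s : ℕ → Formula) (φ : Formula), φ ∈ L → φ.subst s ∈ L

/-- The least tense logic. -/
def Kt : Set Formula := ⋂₀ {L | IsTenseLogic L}

/-- `L ⊕ S`, the least tense logic that contains `L ∪ S`. -/
def oplus (L S : Set Formula) : Set Formula := ⋂₀ {L' | IsTenseLogic L' ∧ L ∪ S ⊆ L'}

/-- The formula `□p → □□p`. -/
def axiomFour : Formula :=
  Formula.imp (Formula.box (Formula.var 0)) (Formula.box (Formula.box (Formula.var 0)))

/-- `K4_t = K_t ⊕ (□p → □□p)`. -/
def K4t : Set Formula := oplus Kt {axiomFour}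

/-- The tense logics that extend `L₀`. -/
def NExt (L₀ : Set Formula) : Set (Set Formula) := {L | IsTenseLogic L ∧ L₀ ⊆ L}

/-- Kripke frames: a nonempty set with a binary relation. -/
structure Frame : Type (u + 1) where
  carrier : Type u
  nonempty : Nonempty carrier
  rel : carrier → carrier → Prop

/-- The extension of a valuation `V` in a frame to all formulas. -/
def Frame.truth (F : Frame.{u}) (V : ℕ → Set F.carrier) : Formula → Set F.carrier
  | Formula.var n => V n
  | Formula.bot => ∅
  | Formula.imp φ ψ => (F.truth V φ)ᶜ ∪ F.truth V ψ
  | Formula.box φ => {x | ∀ y, F.rel x y → y ∈ F.truth V φ}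
  | Formula.bdia φ => {x | ∃ y, F.rel y x ∧ y ∈ F.truth V φ}

/-- `φ` is valid in `F`. -/
def Frame.Validates (F : Frame.{u}) (φ : Formula) : Prop :=
  ∀ (V : ℕ → Set F.carrier) (x : F.carrier), x ∈ F.truth V φ

/-- `Fr(L)`, the class of all frames that validate every formula of `L`. -/
def Fr (L : Set Formula) : Set Frame.{u} := {F | ∀ φ ∈ L, F.Validates φ}

/-- `Fin(L)`, the class of all finite frames that validate every formula of `L`. -/
def FinFr (L : Set Formula) : Set Frame.{u} := {F | Finite F.carrier ∧ ∀ φ ∈ L, F.Validates φ}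

/-- The degree of Kripke-incompleteness of `L` in `NExt L₀`. -/
noncomputable def deg (L₀ L : Set Formula) : Cardinal.{0} :=
  Cardinal.mk {L' : Set Formula // L' ∈ NExt L₀ ∧ Fr.{u} L' = Fr.{u} L}

/-- The degree of the finite model property of `L` in `NExt L₀`. -/
noncomputable def df (L₀ L : Set Formula) : Cardinal.{0} :=
  Cardinal.mk {L' : Set Formula // L' ∈ NExt L₀ ∧ FinFr.{u} L' = FinFr.{u} L}

end Tense

universe v

namespace Tense

open Filter

/-! ### Derived connectives and syntactic measures. -/

namespace Formula

/-! The dividing line is `K4s`. Canonical models and filtration show that `K4t` is complete for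
finite transitive frames, and `K4s` for those without isolated irreflexive points. If `L ⊆ K4s`,
every logic with the finite frames of `L` also lies below `K4s`. The only such logics are `K4t` and
`K4s`, because `K4t` is the intersection of `K4s` with the logic of the isolated point, and this
point tells them apart. Both degrees are then 1.

Otherwise some `φ ∈ L` fails in a finite transitive frame `F` without isolated points. For `I ⊆ ℕ`,
multiply `F` by a fence as long as the modal depth of `φ`, so that `φ` still fails at the far end.
Let the near end see the last point of an infinite chain on which admissible sets are finite or
cofinite, and code `I` by initial points, the spikes (`towerFrame`). If a Kripke frame of `L ∩
towerLogic F n I` refuted `φ ∈ L` at a point, the whole tower logic would be true at that point,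
since disjunctions of `φ` with its members lie in the intersection. This forces nearby points of all
large depths, and colouring them by the parity of their depth violates `alternation`, which holds in
the tower because no admissible set splits the chain. So the intersection has the same frames as `L`
(`Fr_inter_towerLogic`). The disjunction of `φ` with the presence of a coded initial point recovers
`I`, so continuum many logics share the frames of `L`. The rest is `deg ≤ df ≤ 2^ℵ₀`. -/

abbrev neg (φ : Formula) : Formula := imp φ bot
abbrev top : Formula := neg bot
abbrev or (φ ψ : Formula) : Formula := imp (neg φ) ψ
abbrev and (φ ψ : Formula) : Formula := neg (imp φ (neg ψ))
abbrev dia (φ : Formula) : Formula := neg (box (neg φ))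
abbrev bbox (φ : Formula) : Formula := neg (bdia (neg φ))

/-- `φ` holds here, or at an immediate successor or predecessor. -/
def near (φ : Formula) : Formula := or φ (or (dia φ) (bdia φ))

/-- `φ` holds within `n` steps forwards or backwards. -/
def within (n : ℕ) (φ : Formula) : Formula := near^[n] φ

/-- `φ` holds everywhere within `n` steps forwards or backwards. -/
def throughout (n : ℕ) (φ : Formula) : Formula := neg (within n (neg φ))

/-- Every chain of successors has fewer than `n` steps. -/
def depthLT (n : ℕ) : Formula := box^[n] bot

/-- The longest chain of successors has `n` steps. -/
def depthEq (n : ℕ) : Formula := and (depthLT (n + 1)) (neg (depthLT n))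

/-- A point of depth `n` that has a predecessor. -/
def innerDepth (n : ℕ) : Formula := and (depthEq n) (bdia top)

/-- A point of depth `n` that has no predecessor. -/
def initialDepth (n : ℕ) : Formula := and (depthEq n) (neg (bdia top))

/-- The point is not an isolated irreflexive point. -/
def nonIsolated : Formula := or (dia top) (bdia top)

/-- Modal depth. -/
def depth : Formula → ℕ
  | var _ => 0
  | bot => 0
  | imp φ ψ => max (depth φ) (depth ψ)
  | box φ => depth φ + 1
  | bdia φ => depth φ + 1

/-- A bound for the indices of the variables of a formula. -/
def varBound : Formula → ℕ
  | var n => n + 1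
  | bot => 0
  | imp φ ψ => max (varBound φ) (varBound ψ)
  | box φ => varBound φ
  | bdia φ => varBound φ

/-- The set of subformulas. -/
def subformulas : Formula → Set Formula
  | var n => {var n}
  | bot => {bot}
  | imp φ ψ => {imp φ ψ} ∪ (subformulas φ ∪ subformulas ψ)
  | box φ => {box φ} ∪ subformulas φ
  | bdia φ => {bdia φ} ∪ subformulas φ

theorem subformulas_finite (φ : Formula) : φ.subformulas.Finite := by
  induction φ with
  | var n => exact Set.finite_singleton _
  | bot => exact Set.finite_singleton _
  | imp φ ψ h₁ h₂ => exact (Set.finite_singleton _).union (h₁.union h₂)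
  | box φ h => exact (Set.finite_singleton _).union h
  | bdia φ h => exact (Set.finite_singleton _).union h

theorem mem_subformulas_self (φ : Formula) : φ ∈ φ.subformulas := by
  cases φ <;> simp [subformulas]

theorem subformulas_subset {φ ψ : Formula} (h : ψ ∈ φ.subformulas) :
    ψ.subformulas ⊆ φ.subformulas := by
  induction φ with
  | var n => obtain rfl : ψ = var n := h; rfl
  | bot => obtain rfl : ψ = bot := h; rfl
  | imp φ₁ φ₂ h₁ h₂ =>
    rcases h with rfl | h | h
    · rfl
    · exact fun x hx => Or.inr (Or.inl (h₁ h hx))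
    · exact fun x hx => Or.inr (Or.inr (h₂ h hx))
  | box φ h₁ =>
    rcases h with rfl | h
    · rfl
    · exact fun x hx => Or.inr (h₁ h hx)
  | bdia φ h₁ =>
    rcases h with rfl | h
    · rfl
    · exact fun x hx => Or.inr (h₁ h hx)

/-- The truth assignments that treat `⊥` and `→` classically. -/
def IsClassical (v : Formula → Prop) : Prop :=
  ¬ v bot ∧ ∀ α β, v (imp α β) ↔ (v α → v β)

theorem countable_formula : Countable Formula := by
  let S : ℕ → Set Formula := fun n => Nat.rec ∅ (fun _ T =>
    Set.range var ∪ {bot} ∪ Set.image2 imp T T ∪ box '' T ∪ bdia '' T) n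
  have hS : ∀ n, (S n).Countable := by
    intro n
    induction n with
    | zero => exact Set.countable_empty
    | succ n ih =>
      exact ((((Set.countable_range _).union (Set.countable_singleton _)).union
        (ih.image2 ih _)).union (ih.image _)).union (ih.image _)
  have hmono : Monotone S := by
    refine monotone_nat_of_le_succ fun n => ?_
    induction n with
    | zero => exact Set.empty_subset _
    | succ n ih =>
      exact Set.union_subset_union (Set.union_subset_union (Set.union_subset_union_right _
        (Set.image2_subset ih ih)) (Set.image_mono ih)) (Set.image_mono ih)
  have hmem : ∀ φ : Formula, ∃ n, φ ∈ S n := by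
    intro φ
    induction φ with
    | var n => exact ⟨1, Or.inl (Or.inl (Or.inl (Or.inl ⟨n, rfl⟩)))⟩
    | bot => exact ⟨1, Or.inl (Or.inl (Or.inl (Or.inr rfl)))⟩
    | imp φ ψ h₁ h₂ =>
      obtain ⟨n, hn⟩ := h₁
      obtain ⟨m, hm⟩ := h₂
      exact ⟨max n m + 1, Or.inl (Or.inl (Or.inr ⟨φ, hmono (le_max_left _ _) hn, ψ,
        hmono (le_max_right _ _) hm, rfl⟩))⟩
    | box φ h =>
      obtain ⟨n, hn⟩ := h
      exact ⟨n + 1, Or.inl (Or.inr ⟨φ, hn, rfl⟩)⟩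
    | bdia φ h =>
      obtain ⟨n, hn⟩ := h
      exact ⟨n + 1, Or.inr ⟨φ, hn, rfl⟩⟩
  rw [← Set.countable_univ_iff]
  exact (Set.countable_iUnion hS).mono fun φ _ => Set.mem_iUnion.2 (hmem φ)

end Formula

open Formula

/-! ### Semantics -/

section Semantics

variable (F : Frame.{u}) (V : ℕ → Set F.carrier)

theorem mem_truth_imp {x : F.carrier} {φ ψ : Formula} :
    x ∈ F.truth V (imp φ ψ) ↔ (x ∈ F.truth V φ → x ∈ F.truth V ψ) := by
  simp only [Frame.truth, Set.mem_union, Set.mem_compl_iff]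
  tauto

theorem not_mem_truth_bot {x : F.carrier} : x ∉ F.truth V bot := fun h => h

theorem mem_truth_neg {x : F.carrier} {φ : Formula} :
    x ∈ F.truth V (neg φ) ↔ x ∉ F.truth V φ :=
  mem_truth_imp F V

theorem mem_truth_top {x : F.carrier} : x ∈ F.truth V top :=
  (mem_truth_neg F V).2 (not_mem_truth_bot F V)

theorem mem_truth_or {x : F.carrier} {φ ψ : Formula} :
    x ∈ F.truth V (or φ ψ) ↔ (x ∈ F.truth V φ ∨ x ∈ F.truth V ψ) := by
  rw [mem_truth_imp, mem_truth_neg]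
  tauto

theorem mem_truth_and {x : F.carrier} {φ ψ : Formula} :
    x ∈ F.truth V (and φ ψ) ↔ (x ∈ F.truth V φ ∧ x ∈ F.truth V ψ) := by
  rw [mem_truth_neg, mem_truth_imp, mem_truth_neg]
  tauto

theorem mem_truth_box {x : F.carrier} {φ : Formula} :
    x ∈ F.truth V (box φ) ↔ ∀ y, F.rel x y → y ∈ F.truth V φ := Iff.rfl

theorem mem_truth_bdia {x : F.carrier} {φ : Formula} :
    x ∈ F.truth V (bdia φ) ↔ ∃ y, F.rel y x ∧ y ∈ F.truth V φ := Iff.rfl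

theorem mem_truth_dia {x : F.carrier} {φ : Formula} :
    x ∈ F.truth V (dia φ) ↔ ∃ y, F.rel x y ∧ y ∈ F.truth V φ := by
  rw [mem_truth_neg, mem_truth_box]
  simp [mem_truth_neg]

theorem mem_truth_bbox {x : F.carrier} {φ : Formula} :
    x ∈ F.truth V (bbox φ) ↔ ∀ y, F.rel y x → y ∈ F.truth V φ := by
  rw [mem_truth_neg, mem_truth_bdia]
  simp [mem_truth_neg]

theorem mem_truth_nonIsolated {x : F.carrier} :
    x ∈ F.truth V nonIsolated ↔ (∃ y, F.rel x y) ∨ ∃ y, F.rel y x := by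
  rw [nonIsolated, mem_truth_or, mem_truth_dia, mem_truth_bdia]
  simp [mem_truth_top]

theorem mem_truth_near {x : F.carrier} {φ : Formula} :
    x ∈ F.truth V (near φ) ↔
      ∃ y, (x = y ∨ F.rel x y ∨ F.rel y x) ∧ y ∈ F.truth V φ := by
  rw [near, mem_truth_or, mem_truth_or, mem_truth_dia, mem_truth_bdia]
  constructor
  · rintro (h | ⟨y, h, h'⟩ | ⟨y, h, h'⟩)
    · exact ⟨x, Or.inl rfl, h⟩
    · exact ⟨y, Or.inr (Or.inl h), h'⟩
    · exact ⟨y, Or.inr (Or.inr h), h'⟩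
  · rintro ⟨y, rfl | h | h, h'⟩
    · exact Or.inl h'
    · exact Or.inr (Or.inl ⟨y, h, h'⟩)
    · exact Or.inr (Or.inr ⟨y, h, h'⟩)

/-- There is a path of at most `n` steps, forwards or backwards. -/
def Frame.Reach (F : Frame.{u}) : ℕ → F.carrier → F.carrier → Prop
  | 0, x, y => x = y
  | n + 1, x, y => ∃ z, (x = z ∨ F.rel x z ∨ F.rel z x) ∧ Frame.Reach F n z y

variable {F} in
theorem Frame.Reach.snoc {n : ℕ} {x y z : F.carrier} (h : F.Reach n x y)
    (h' : y = z ∨ F.rel y z ∨ F.rel z y) : F.Reach (n + 1) x z := by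
  induction n generalizing x with
  | zero => obtain rfl : x = y := h; exact ⟨z, h', rfl⟩
  | succ n ih =>
    obtain ⟨w, hw, hwy⟩ := h
    exact ⟨w, hw, ih hwy⟩

variable {F} in
theorem Frame.Reach.mono {n m : ℕ} (hnm : n ≤ m) {x y : F.carrier} (h : F.Reach n x y) :
    F.Reach m x y := by
  induction hnm with
  | refl => exact h
  | step _ ih => exact ih.snoc (Or.inl rfl)

theorem mem_truth_within {n : ℕ} {x : F.carrier} {φ : Formula} :
    x ∈ F.truth V (within n φ) ↔ ∃ y, F.Reach n x y ∧ y ∈ F.truth V φ := by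
  induction n generalizing x with
  | zero => simp [within, Frame.Reach]
  | succ n ih =>
    rw [within, Function.iterate_succ_apply', mem_truth_near]
    change (∃ y, _ ∧ y ∈ F.truth V (within n φ)) ↔ _
    simp only [ih, Frame.Reach]
    constructor
    · rintro ⟨z, hz, y, hy, h⟩
      exact ⟨y, ⟨z, hz, hy⟩, h⟩
    · rintro ⟨y, ⟨z, hz, hy⟩, h⟩
      exact ⟨z, hz, y, hy, h⟩

theorem mem_truth_throughout {n : ℕ} {x : F.carrier} {φ : Formula} :
    x ∈ F.truth V (throughout n φ) ↔ ∀ y, F.Reach n x y → y ∈ F.truth V φ := by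
  rw [throughout, mem_truth_neg, mem_truth_within]
  simp [mem_truth_neg]

theorem mem_truth_depthLT_succ {n : ℕ} {x : F.carrier} :
    x ∈ F.truth V (depthLT (n + 1)) ↔ ∀ y, F.rel x y → y ∈ F.truth V (depthLT n) := by
  rw [depthLT, Function.iterate_succ_apply', mem_truth_box]
  rfl

theorem truth_depthLT_mono : Monotone fun n => F.truth V (depthLT n) := by
  refine monotone_nat_of_le_succ fun n => ?_
  induction n with
  | zero => exact Set.empty_subset _
  | succ n ih =>
    intro x hx
    rw [mem_truth_depthLT_succ] at hx ⊢
    exact fun y hy => ih (hx y hy)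

theorem mem_truth_depthEq {n : ℕ} {x : F.carrier} : x ∈ F.truth V (depthEq n) ↔
    x ∈ F.truth V (depthLT (n + 1)) ∧ x ∉ F.truth V (depthLT n) := by
  rw [depthEq, mem_truth_and, mem_truth_neg]

theorem depthEq_unique {n m : ℕ} {x : F.carrier} (hn : x ∈ F.truth V (depthEq n))
    (hm : x ∈ F.truth V (depthEq m)) : n = m := by
  rw [mem_truth_depthEq] at hn hm
  rcases lt_trichotomy n m with h | h | h
  · exact absurd (truth_depthLT_mono F V h hn.1) hm.2
  · exact h
  · exact absurd (truth_depthLT_mono F V h hm.1) hn.2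

theorem mem_truth_innerDepth {n : ℕ} {x : F.carrier} : x ∈ F.truth V (innerDepth n) ↔
    x ∈ F.truth V (depthEq n) ∧ ∃ y, F.rel y x := by
  rw [innerDepth, mem_truth_and, mem_truth_bdia]
  simp [mem_truth_top]

theorem mem_truth_initialDepth {n : ℕ} {x : F.carrier} : x ∈ F.truth V (initialDepth n) ↔
    x ∈ F.truth V (depthEq n) ∧ ¬ ∃ y, F.rel y x := by
  rw [initialDepth, mem_truth_and, mem_truth_neg, mem_truth_bdia]
  simp [mem_truth_top]

theorem truth_subst (s : ℕ → Formula) (φ : Formula) :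
    F.truth V (φ.subst s) = F.truth (fun n => F.truth V (s n)) φ := by
  induction φ with
  | var n => rfl
  | bot => rfl
  | imp φ ψ h₁ h₂ => simp only [Formula.subst, Frame.truth, h₁, h₂]
  | box φ h => simp only [Formula.subst, Frame.truth, h]
  | bdia φ h => simp only [Formula.subst, Frame.truth, h]

variable {V} in
theorem truth_congr {W : ℕ → Set F.carrier} {φ : Formula}
    (h : ∀ n < φ.varBound, V n = W n) : F.truth V φ = F.truth W φ := by
  induction φ with
  | var n => exact h n (Nat.lt_succ_self n)
  | bot => rfl
  | imp φ ψ h₁ h₂ =>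
    simp only [Frame.truth, h₁ fun n hn => h n (lt_max_of_lt_left hn),
      h₂ fun n hn => h n (lt_max_of_lt_right hn)]
  | box φ ih => simp only [Frame.truth, ih h]
  | bdia φ ih => simp only [Frame.truth, ih h]

theorem truth_depthLT_congr (W : ℕ → Set F.carrier) (n : ℕ) :
    F.truth V (depthLT n) = F.truth W (depthLT n) := by
  have h : (depthLT n).varBound = 0 := by
    induction n with
    | zero => rfl
    | succ n ih => rw [depthLT, Function.iterate_succ_apply']; exact ih
  exact truth_congr F fun m hm => absurd hm (by omega)

theorem truth_innerDepth_congr (W : ℕ → Set F.carrier) (n : ℕ) :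
    F.truth V (innerDepth n) = F.truth W (innerDepth n) := by
  ext x
  rw [mem_truth_innerDepth, mem_truth_innerDepth, mem_truth_depthEq, mem_truth_depthEq,
    truth_depthLT_congr F V W, truth_depthLT_congr F V W]

end Semantics

/-! ### Logics of general frames -/

/-- Set algebras on a frame that are closed under the operations of tense logic. -/
structure Admissible (F : Frame.{u}) (𝒜 : Set (Set F.carrier)) : Prop where
  empty : ∅ ∈ 𝒜
  imp : ∀ A ∈ 𝒜, ∀ B ∈ 𝒜, Aᶜ ∪ B ∈ 𝒜
  box : ∀ A ∈ 𝒜, {x | ∀ y, F.rel x y → y ∈ A} ∈ 𝒜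
  bdia : ∀ A ∈ 𝒜, {x | ∃ y, F.rel y x ∧ y ∈ A} ∈ 𝒜

/-- The formulas that are valid in the general frame `(F, 𝒜)`. -/
def logicOf (F : Frame.{u}) (𝒜 : Set (Set F.carrier)) : Set Formula :=
  {φ | ∀ V : ℕ → Set F.carrier, (∀ n, V n ∈ 𝒜) → ∀ x, x ∈ F.truth V φ}

theorem Admissible.truth_mem {F : Frame.{u}} {𝒜 : Set (Set F.carrier)} (h𝒜 : Admissible F 𝒜)
    {V : ℕ → Set F.carrier} (hV : ∀ n, V n ∈ 𝒜) (φ : Formula) : F.truth V φ ∈ 𝒜 := by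
  induction φ with
  | var n => exact hV n
  | bot => exact h𝒜.empty
  | imp φ ψ h₁ h₂ => exact h𝒜.imp _ h₁ _ h₂
  | box φ h => exact h𝒜.box _ h
  | bdia φ h => exact h𝒜.bdia _ h

theorem Admissible.isTenseLogic {F : Frame.{u}} {𝒜 : Set (Set F.carrier)}
    (h𝒜 : Admissible F 𝒜) : IsTenseLogic (logicOf F 𝒜) where
  taut φ hφ V _ x := hφ (fun ψ => x ∈ F.truth V ψ) (not_mem_truth_bot F V)
    fun _ _ => mem_truth_imp F V
  residuation φ ψ := by
    refine forall₂_congr fun V _ => ?_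
    simp only [mem_truth_imp, mem_truth_box, mem_truth_bdia]
    constructor
    · exact fun h x hx y hxy => h y ⟨x, hxy, hx⟩
    · rintro h y ⟨x, hxy, hx⟩
      exact h x hx y hxy
  mp φ ψ h₁ h₂ V hV x := (mem_truth_imp F V).1 (h₂ V hV x) (h₁ V hV x)
  subst s φ h V hV x := by
    rw [truth_subst]
    exact h _ (fun n => h𝒜.truth_mem hV (s n)) x

theorem Admissible.univ (F : Frame.{u}) : Admissible F Set.univ := by
  constructor <;> intros <;> trivial

theorem mem_logicOf_univ {F : Frame.{u}} {φ : Formula} :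
    φ ∈ logicOf F Set.univ ↔ F.Validates φ :=
  ⟨fun h V x => h V (fun _ => trivial) x, fun h V _ x => h V x⟩

theorem isTenseLogic_sInter {S : Set (Set Formula)} (hS : ∀ L ∈ S, IsTenseLogic L) :
    IsTenseLogic (⋂₀ S) where
  taut φ hφ L hL := (hS L hL).taut φ hφ
  residuation φ ψ := forall₂_congr fun L hL => (hS L hL).residuation φ ψ
  mp φ ψ h₁ h₂ L hL := (hS L hL).mp φ ψ (h₁ L hL) (h₂ L hL)
  subst s φ h L hL := (hS L hL).subst s φ (h L hL)

theorem IsTenseLogic.inter {L L' : Set Formula} (h : IsTenseLogic L) (h' : IsTenseLogic L') :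
    IsTenseLogic (L ∩ L') := by
  rw [← Set.sInter_pair]
  refine isTenseLogic_sInter ?_
  rintro M (rfl | rfl)
  exacts [h, h']

theorem isTenseLogic_oplus (L S : Set Formula) : IsTenseLogic (oplus L S) :=
  isTenseLogic_sInter fun _ h => h.1

theorem subset_oplus (L S : Set Formula) : L ∪ S ⊆ oplus L S :=
  Set.subset_sInter fun _ h => h.2

theorem oplus_subset {L S M : Set Formula} (hM : IsTenseLogic M) (h : L ∪ S ⊆ M) :
    oplus L S ⊆ M :=
  Set.sInter_subset_of_mem ⟨hM, h⟩

theorem isTenseLogic_K4t : IsTenseLogic K4t := isTenseLogic_oplus _ _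

theorem axiomFour_mem_K4t : axiomFour ∈ K4t := subset_oplus _ _ (Or.inr rfl)

theorem K4t_subset {M : Set Formula} (hM : IsTenseLogic M) (h : axiomFour ∈ M) : K4t ⊆ M :=
  oplus_subset hM (Set.union_subset (Set.sInter_subset_of_mem hM) (by simpa using h))

theorem K4t_subset_logicOf {F : Frame.{u}} {𝒜 : Set (Set F.carrier)} (h𝒜 : Admissible F 𝒜)
    (hF : ∀ x y z, F.rel x y → F.rel y z → F.rel x z) : K4t ⊆ logicOf F 𝒜 := by
  refine K4t_subset h𝒜.isTenseLogic fun V _ x => ?_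
  rw [axiomFour, mem_truth_imp]
  exact fun h y hxy z hyz => h z (hF x y z hxy hyz)

/-- The extension of `K4t` that excludes exactly the isolated irreflexive points. -/
def K4s : Set Formula := oplus K4t {nonIsolated}

theorem isTenseLogic_K4s : IsTenseLogic K4s := isTenseLogic_oplus _ _

theorem K4t_subset_K4s : K4t ⊆ K4s := fun _ h => subset_oplus _ _ (Or.inl h)

theorem nonIsolated_mem_K4s : nonIsolated ∈ K4s := subset_oplus _ _ (Or.inr rfl)

theorem K4s_subset {M : Set Formula} (hM : M ∈ NExt K4t) (h : nonIsolated ∈ M) : K4s ⊆ M :=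
  oplus_subset hM.1 (Set.union_subset hM.2 (by simpa using h))

/-! ### Completeness of `K4t` -/

section Completeness

variable {L : Set Formula}

/-- A set of formulas closed under classical propositional consequence is determined by the
truth assignments that satisfy it. -/
theorem exists_classical {T : Set Formula} (ht : ∀ φ : Formula, φ.IsTautology → φ ∈ T)
    (hmp : ∀ φ ψ : Formula, φ ∈ T → imp φ ψ ∈ T → ψ ∈ T) {ψ : Formula} (hψ : ψ ∉ T) :
    ∃ v, IsClassical v ∧ (∀ χ ∈ T, v χ) ∧ ¬ v ψ := by
  classical
  have key : ∀ (Γ : Finset {χ // χ ∈ T}) (ψ : Formula),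
      (∀ v, IsClassical v → (∀ γ ∈ Γ, v γ.1) → v ψ) → ψ ∈ T := by
    intro Γ
    induction Γ using Finset.induction_on with
    | empty => exact fun ψ h => ht ψ fun v h₁ h₂ => h v ⟨h₁, h₂⟩ (by simp)
    | insert γ Γ _ ih =>
      intro ψ h
      refine hmp γ.1 ψ γ.2 (ih _ fun v hv hΓ => (hv.2 _ _).2 fun hγ => h v hv ?_)
      intro δ hδ
      rcases Finset.mem_insert.1 hδ with rfl | hδ
      exacts [hγ, hΓ δ hδ]
  have hex : ∀ Γ : Finset {χ // χ ∈ T}, ∃ v, IsClassical v ∧ (∀ γ ∈ Γ, v γ.1) ∧ ¬ v ψ := by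
    intro Γ
    by_contra! h
    exact hψ (key Γ ψ h)
  choose v hv hvΓ hvψ using hex
  -- Compactness: a limit along an ultrafilter on the finite sets of premises commutes with
  -- implication, and each premise eventually holds.
  let U : Ultrafilter (Finset {χ // χ ∈ T}) := Ultrafilter.of atTop
  refine ⟨fun χ => ∀ᶠ Γ in U, v Γ χ, ⟨?_, fun α β => ?_⟩, fun χ hχ => ?_, ?_⟩
  · simpa [(hv _).1] using U.neBot.ne
  · simp only [(hv _).2, Ultrafilter.eventually_imp]
  · refine Ultrafilter.of_le atTop ?_
    filter_upwards [eventually_ge_atTop {⟨χ, hχ⟩}] with Γ hΓ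
    exact hvΓ Γ _ (hΓ (Finset.mem_singleton_self _))
  · simpa [hvψ] using U.neBot.ne

/-! ### Normality of both modalities, derived from residuation. -/

theorem IsTenseLogic.nec (hL : IsTenseLogic L) {φ : Formula} (h : φ ∈ L) : box φ ∈ L := by
  have h₁ : imp (bdia top) φ ∈ L :=
    hL.mp _ _ h (hL.taut _ fun v _ hi => by simp only [hi]; tauto)
  exact hL.mp _ _ (hL.taut top fun v _ hi => by simp [hi]) ((hL.residuation _ _).1 h₁)

theorem IsTenseLogic.imp_trans (hL : IsTenseLogic L) {φ ψ χ : Formula} (h₁ : imp φ ψ ∈ L)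
    (h₂ : imp ψ χ ∈ L) : imp φ χ ∈ L :=
  hL.mp _ _ h₂ (hL.mp _ _ h₁ (hL.taut _ fun v _ hi => by simp only [hi]; tauto))

theorem IsTenseLogic.imp_refl (hL : IsTenseLogic L) (φ : Formula) : imp φ φ ∈ L :=
  hL.taut _ fun v _ hi => by simp [hi]

theorem IsTenseLogic.bdia_box (hL : IsTenseLogic L) (φ : Formula) : imp (bdia (box φ)) φ ∈ L :=
  (hL.residuation _ _).2 (hL.imp_refl _)

theorem IsTenseLogic.box_bdia (hL : IsTenseLogic L) (φ : Formula) : imp φ (box (bdia φ)) ∈ L :=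
  (hL.residuation _ _).1 (hL.imp_refl _)

theorem IsTenseLogic.box_mono (hL : IsTenseLogic L) {φ ψ : Formula} (h : imp φ ψ ∈ L) :
    imp (box φ) (box ψ) ∈ L :=
  (hL.residuation _ _).1 (hL.imp_trans (hL.bdia_box φ) h)

theorem IsTenseLogic.bdia_mono (hL : IsTenseLogic L) {φ ψ : Formula} (h : imp φ ψ ∈ L) :
    imp (bdia φ) (bdia ψ) ∈ L :=
  (hL.residuation _ _).2 (hL.imp_trans h (hL.box_bdia ψ))

theorem IsTenseLogic.box_mp (hL : IsTenseLogic L) (φ ψ : Formula) :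
    imp (box (imp φ ψ)) (imp (box φ) (box ψ)) ∈ L := by
  have h₁ : imp (bdia (and (box (imp φ ψ)) (box φ))) (imp φ ψ) ∈ L :=
    hL.imp_trans (hL.bdia_mono (hL.taut _ fun v _ hi => by simp only [hi]; tauto))
      (hL.bdia_box _)
  have h₂ : imp (bdia (and (box (imp φ ψ)) (box φ))) φ ∈ L :=
    hL.imp_trans (hL.bdia_mono (hL.taut _ fun v _ hi => by simp only [hi]; tauto))
      (hL.bdia_box _)
  have h₃ : imp (bdia (and (box (imp φ ψ)) (box φ))) ψ ∈ L :=
    hL.mp _ _ h₂ (hL.mp _ _ h₁ (hL.taut _ fun v _ hi => by simp only [hi]; tauto))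
  exact hL.mp _ _ ((hL.residuation _ _).1 h₃)
    (hL.taut _ fun v _ hi => by simp only [hi]; tauto)

theorem IsTenseLogic.bdia_or (hL : IsTenseLogic L) (φ ψ : Formula) :
    imp (bdia (or φ ψ)) (or (bdia φ) (bdia ψ)) ∈ L := by
  refine (hL.residuation _ _).2 ?_
  have h₁ : imp φ (box (or (bdia φ) (bdia ψ))) ∈ L :=
    hL.imp_trans (hL.box_bdia φ)
      (hL.box_mono (hL.taut _ fun v _ hi => by simp only [hi]; tauto))
  have h₂ : imp ψ (box (or (bdia φ) (bdia ψ))) ∈ L :=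
    hL.imp_trans (hL.box_bdia ψ)
      (hL.box_mono (hL.taut _ fun v _ hi => by simp only [hi]; tauto))
  exact hL.mp _ _ h₂ (hL.mp _ _ h₁ (hL.taut _ fun v _ hi => by simp only [hi]; tauto))

/-- Maximal consistent sets, as truth assignments. -/
abbrev World (L : Set Formula) : Type :=
  {v : Formula → Prop // IsClassical v ∧ ∀ χ ∈ L, v χ}

/-! ### The canonical model. -/

namespace World

def Rel (v w : World L) : Prop := ∀ χ, v.1 (box χ) → w.1 χ

theorem imp_iff (v : World L) (φ ψ : Formula) : v.1 (imp φ ψ) ↔ (v.1 φ → v.1 ψ) := v.2.1.2 φ ψ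

theorem not_bot (v : World L) : ¬ v.1 bot := v.2.1.1

theorem of_imp_mem (v : World L) {φ ψ : Formula} (h : imp φ ψ ∈ L) (hφ : v.1 φ) : v.1 ψ :=
  (v.imp_iff _ _).1 (v.2.2 _ h) hφ

theorem rel_iff (hL : IsTenseLogic L) (v w : World L) :
    v.Rel w ↔ ∀ χ, v.1 χ → w.1 (bdia χ) :=
  ⟨fun h χ hχ => h _ (v.of_imp_mem (hL.box_bdia χ) hχ),
    fun h χ hχ => w.of_imp_mem (hL.bdia_box χ) (h _ hχ)⟩

theorem exists_of_theory {T : Set Formula} (hLT : L ⊆ T) (hL : IsTenseLogic L)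
    (hmp : ∀ φ ψ : Formula, φ ∈ T → imp φ ψ ∈ T → ψ ∈ T) {ψ : Formula} (hψ : ψ ∉ T) :
    ∃ w : World L, (∀ χ ∈ T, w.1 χ) ∧ ¬ w.1 ψ := by
  obtain ⟨w, hw, hwT, hwψ⟩ := exists_classical (fun φ hφ => hLT (hL.taut φ hφ)) hmp hψ
  exact ⟨⟨w, hw, fun χ hχ => hwT χ (hLT hχ)⟩, hwT, hwψ⟩

theorem box_iff (hL : IsTenseLogic L) (v : World L) (ψ : Formula) :
    v.1 (box ψ) ↔ ∀ w : World L, v.Rel w → w.1 ψ := by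
  refine ⟨fun h w hw => hw ψ h, fun h => ?_⟩
  by_contra hψ
  obtain ⟨w, hw, hwψ⟩ := exists_of_theory (T := {χ | v.1 (box χ)})
    (fun χ hχ => v.2.2 _ (hL.nec hχ)) hL
    (fun φ χ h₁ h₂ => (v.imp_iff _ _).1 (v.of_imp_mem (hL.box_mp φ χ) h₂) h₁) hψ
  exact hwψ (h w hw)

theorem bdia_iff (hL : IsTenseLogic L) (v : World L) (ψ : Formula) :
    v.1 (bdia ψ) ↔ ∃ w : World L, w.Rel v ∧ w.1 ψ := by
  refine ⟨fun h => ?_, fun ⟨w, hw, hψ⟩ => (rel_iff hL w v).1 hw ψ hψ⟩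
  have hneg : ∀ φ : Formula, v.1 (neg φ) ↔ ¬ v.1 φ := fun φ => by
    simp [v.imp_iff, v.not_bot]
  have hor : ∀ φ χ : Formula, v.1 (or φ χ) ↔ (v.1 φ ∨ v.1 χ) := fun φ χ => by
    rw [v.imp_iff, hneg]; tauto
  -- The theory says that `ψ → χ` held throughout the past. It contains `ψ`, is closed under modus
  -- ponens by `bdia_or`, and omits `⊥` because `⧫ψ` holds at `v`.
  obtain ⟨w, hw, -⟩ := exists_of_theory (T := {χ | ¬ v.1 (bdia (neg (imp ψ χ)))}) (ψ := bot)
    (fun χ hχ h' => v.not_bot (v.of_imp_mem ((hL.residuation _ _).2 (hL.mp _ _ hχ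
      (hL.taut _ fun u _ hi => by simp only [hi]; tauto))) h')) hL
    (fun φ χ h₁ h₂ h₃ => by
      have h₄ := v.of_imp_mem (hL.imp_trans (hL.bdia_mono (ψ := or (neg (imp ψ φ))
        (neg (imp ψ (imp φ χ)))) (hL.taut _ fun u _ hi => by simp only [hi]; tauto))
        (hL.bdia_or _ _)) h₃
      exact ((hor _ _).1 h₄).elim h₁ h₂)
    (fun h' => h' (v.of_imp_mem (hL.bdia_mono
      (hL.taut _ fun u _ hi => by simp only [hi]; tauto)) h))
  refine ⟨w, (rel_iff hL w v).2 fun χ hχ => ?_, hw ψ fun h' => v.not_bot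
    (v.of_imp_mem ((hL.residuation _ _).2 (hL.taut _ fun u _ hi => by simp only [hi]; tauto)) h')⟩
  by_contra h'
  have : w.1 (neg χ) := hw _ fun h'' => h' (v.of_imp_mem (hL.bdia_mono
      (hL.taut _ fun u _ hi => by simp only [hi]; tauto)) h'')
  exact w.not_bot ((w.imp_iff _ _).1 this hχ)

theorem rel_trans (hL : IsTenseLogic L) (h4 : axiomFour ∈ L) {u v w : World L}
    (h : u.Rel v) (h' : v.Rel w) : u.Rel w := fun χ hχ =>
  h' χ (h _ (u.of_imp_mem (hL.subst (fun _ => χ) _ h4) hχ))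

end World

theorem exists_transitive_model (hL : IsTenseLogic L) (h4 : axiomFour ∈ L) {φ : Formula}
    (hφ : φ ∉ L) : ∃ F : Frame.{0}, (∀ x y z, F.rel x y → F.rel y z → F.rel x z) ∧
      ∃ (V : ℕ → Set F.carrier) (x : F.carrier), x ∉ F.truth V φ := by
  obtain ⟨w, -, hw⟩ := World.exists_of_theory subset_rfl hL hL.mp hφ
  let F : Frame := ⟨World L, ⟨w⟩, World.Rel⟩
  refine ⟨F, fun x y z h h' => World.rel_trans hL h4 h h', fun n => {v | v.1 (var n)}, w, ?_⟩
  have key : ∀ (ψ : Formula) (v : World L),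
      v ∈ F.truth (fun n => {v | v.1 (var n)}) ψ ↔ v.1 ψ := by
    intro ψ
    induction ψ with
    | var n => exact fun v => Iff.rfl
    | bot => exact fun v => (iff_false_right v.not_bot).2 (not_mem_truth_bot F _)
    | imp ψ χ h₁ h₂ => exact fun v => by rw [mem_truth_imp, h₁, h₂, v.imp_iff]
    | box ψ h =>
      exact fun v => by
        rw [World.box_iff hL]
        exact forall₂_congr fun w _ => h w
    | bdia ψ h =>
      exact fun v => by
        rw [World.bdia_iff hL]
        exact exists_congr fun w => and_congr_right fun _ => h w
  rwa [key]

/-- Filtration of transitive models. -/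
theorem exists_finite_model {F : Frame.{u}} (hF : ∀ x y z, F.rel x y → F.rel y z → F.rel x z)
    {V : ℕ → Set F.carrier} {x : F.carrier} {φ : Formula} (hx : x ∉ F.truth V φ) :
    ∃ F' : Frame.{v}, Finite F'.carrier ∧ (∀ x y z, F'.rel x y → F'.rel y z → F'.rel x z) ∧
      ∃ (V' : ℕ → Set F'.carrier) (x' : F'.carrier), x' ∉ F'.truth V' φ := by
  let t : F.carrier → Set Formula := fun y => {ψ | ψ ∈ φ.subformulas ∧ y ∈ F.truth V ψ}
  have hfin : (Set.range t).Finite :=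
    φ.subformulas_finite.finite_subsets.subset (by
      rintro _ ⟨y, rfl⟩
      exact fun ψ h => h.1)
  let F' : Frame.{v} :=
    { carrier := ULift.{v} (Set.range t)
      nonempty := ⟨⟨⟨t x, x, rfl⟩⟩⟩
      -- The transitive filtration: boxes persist forwards and past diamonds accumulate, so
      -- transitivity is built in.
      rel := fun a b =>
        (∀ ψ, box ψ ∈ a.down.1 → ψ ∈ b.down.1 ∧ box ψ ∈ b.down.1) ∧
        ∀ ψ, bdia ψ ∈ φ.subformulas → (ψ ∈ a.down.1 ∨ bdia ψ ∈ a.down.1) →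
          bdia ψ ∈ b.down.1 }
  let q : F.carrier → F'.carrier := fun y => ⟨⟨t y, y, rfl⟩⟩
  have hq : ∀ a : F'.carrier, ∃ y, q y = a := by
    rintro ⟨⟨_, y, rfl⟩⟩
    exact ⟨y, rfl⟩
  have hrel : ∀ y z, F.rel y z → F'.rel (q y) (q z) := by
    refine fun y z h => ⟨?_, fun ψ h₁ h₂ => ⟨h₁, ?_⟩⟩
    · rintro ψ ⟨h₁, h₂⟩
      exact ⟨⟨subformulas_subset h₁ (Or.inr (mem_subformulas_self ψ)), h₂ z h⟩, h₁,
        fun w hw => h₂ w (hF _ _ _ h hw)⟩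
    · rcases h₂ with h₂ | ⟨-, w, hw, hwψ⟩
      · exact ⟨y, h, h₂.2⟩
      · exact ⟨w, hF _ _ _ hw h, hwψ⟩
  let V' : ℕ → Set F'.carrier := fun n => {a | var n ∈ a.down.1}
  have key : ∀ ψ ∈ φ.subformulas, ∀ y, q y ∈ F'.truth V' ψ ↔ y ∈ F.truth V ψ := by
    intro ψ
    induction ψ with
    | var n => exact fun h y => ⟨fun h' => h'.2, fun h' => ⟨h, h'⟩⟩
    | bot => exact fun h y => Iff.rfl
    | imp ψ χ h₁ h₂ =>
      intro h y
      have h₃ := subformulas_subset h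
      rw [mem_truth_imp, mem_truth_imp, h₁ (h₃ (Or.inr (Or.inl (mem_subformulas_self ψ)))),
        h₂ (h₃ (Or.inr (Or.inr (mem_subformulas_self χ))))]
    | box ψ ih =>
      intro h y
      have hψ := subformulas_subset h (Or.inr (mem_subformulas_self ψ))
      refine ⟨fun h' z hz => (ih hψ z).1 (h' _ (hrel y z hz)), fun h' a ha => ?_⟩
      obtain ⟨z, rfl⟩ := hq a
      exact (ih hψ z).2 (ha.1 ψ ⟨h, h'⟩).1.2
    | bdia ψ ih =>
      intro h y
      have hψ := subformulas_subset h (Or.inr (mem_subformulas_self ψ))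
      refine ⟨fun ⟨a, ha, ha'⟩ => ?_, fun ⟨z, hz, hz'⟩ => ⟨q z, hrel z y hz, (ih hψ z).2 hz'⟩⟩
      obtain ⟨z, rfl⟩ := hq a
      exact (ha.2 ψ h (Or.inl ⟨hψ, (ih hψ z).1 ha'⟩)).2
  refine ⟨F', ?_, ?_, V', q x, fun h => hx ((key φ (mem_subformulas_self φ) x).1 h)⟩
  · have := hfin.to_subtype
    exact inferInstanceAs (Finite (ULift _))
  · exact fun a b c h h' => ⟨fun ψ hψ => h'.1 ψ (h.1 ψ hψ).2,
      fun ψ h₁ h₂ => h'.2 ψ h₁ (Or.inr (h.2 ψ h₁ h₂))⟩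

theorem exists_finite_countermodel_of_notMem_K4t {φ : Formula} (hφ : φ ∉ K4t) :
    ∃ F : Frame.{u}, Finite F.carrier ∧ (∀ x y z, F.rel x y → F.rel y z → F.rel x z) ∧
      ∃ (V : ℕ → Set F.carrier) (x : F.carrier), x ∉ F.truth V φ := by
  obtain ⟨F, hF, V, x, hx⟩ := exists_transitive_model isTenseLogic_K4t axiomFour_mem_K4t hφ
  exact exists_finite_model hF hx

end Completeness

/-! ### Isolated points -/

/-- Discarding the isolated points of a frame does not affect the truth of formulas at the
remaining points. -/
theorem exists_nonIsolated_model {F : Frame.{u}} [Finite F.carrier]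
    (hF : ∀ x y z, F.rel x y → F.rel y z → F.rel x z)
    {V : ℕ → Set F.carrier} {x : F.carrier} {φ : Formula} (hx : x ∉ F.truth V φ)
    (hxi : x ∈ F.truth V nonIsolated) :
    ∃ F' : Frame.{u}, Finite F'.carrier ∧ (∀ x y z, F'.rel x y → F'.rel y z → F'.rel x z) ∧
      (∀ x, (∃ y, F'.rel x y) ∨ ∃ y, F'.rel y x) ∧ ¬ F'.Validates φ := by
  let P : F.carrier → Prop := fun x => (∃ y, F.rel x y) ∨ ∃ y, F.rel y x
  let F' : Frame.{u} := ⟨{x // P x}, ⟨⟨x, (mem_truth_nonIsolated F V).1 hxi⟩⟩,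
    fun a b => F.rel a.1 b.1⟩
  let V' : ℕ → Set F'.carrier := fun n => {a | a.1 ∈ V n}
  have key : ∀ (ψ : Formula) (a : F'.carrier), a ∈ F'.truth V' ψ ↔ a.1 ∈ F.truth V ψ := by
    intro ψ
    induction ψ with
    | var n => exact fun a => Iff.rfl
    | bot => exact fun a => Iff.rfl
    | imp ψ χ h₁ h₂ => exact fun a => by rw [mem_truth_imp, mem_truth_imp, h₁, h₂]
    | box ψ ih =>
      exact fun a => ⟨fun h y hy => (ih ⟨y, Or.inr ⟨_, hy⟩⟩).1 (h ⟨y, Or.inr ⟨_, hy⟩⟩ hy),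
        fun h b hb => (ih b).2 (h b.1 hb)⟩
    | bdia ψ ih =>
      exact fun a => ⟨fun ⟨b, hb, h⟩ => ⟨b.1, hb, (ih b).1 h⟩,
        fun ⟨y, hy, h⟩ => ⟨⟨y, Or.inl ⟨_, hy⟩⟩, hy, (ih ⟨y, Or.inl ⟨_, hy⟩⟩).2 h⟩⟩
  refine ⟨F', inferInstanceAs (Finite {x // P x}), fun a b c => hF a.1 b.1 c.1, ?_,
    fun h => hx ((key φ ⟨x, (mem_truth_nonIsolated F V).1 hxi⟩).1 (h V' _))⟩
  rintro ⟨a, ⟨y, hy⟩ | ⟨y, hy⟩⟩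
  · exact Or.inl ⟨⟨y, Or.inr ⟨_, hy⟩⟩, hy⟩
  · exact Or.inr ⟨⟨y, Or.inl ⟨_, hy⟩⟩, hy⟩

theorem validates_of_mem_K4t {F : Frame.{u}}
    (hF : ∀ x y z, F.rel x y → F.rel y z → F.rel x z) {φ : Formula} (h : φ ∈ K4t) :
    F.Validates φ :=
  mem_logicOf_univ.1 (K4t_subset_logicOf (Admissible.univ F) hF h)

theorem validates_of_mem_K4s {F : Frame.{u}}
    (hF : ∀ x y z, F.rel x y → F.rel y z → F.rel x z)
    (hi : ∀ x, (∃ y, F.rel x y) ∨ ∃ y, F.rel y x) {φ : Formula} (h : φ ∈ K4s) :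
    F.Validates φ :=
  mem_logicOf_univ.1 (K4s_subset
    ⟨(Admissible.univ F).isTenseLogic, K4t_subset_logicOf (Admissible.univ F) hF⟩
    (mem_logicOf_univ.2 fun V x => (mem_truth_nonIsolated F V).2 (hi x)) h)

/-- A finite `K4t`-countermodel to `nonIsolated → φ` keeps its refutation of `φ` after its isolated
points are dropped. -/
theorem exists_finite_countermodel_of_notMem_K4s {φ : Formula} (hφ : φ ∉ K4s) :
    ∃ F : Frame.{u}, Finite F.carrier ∧ (∀ x y z, F.rel x y → F.rel y z → F.rel x z) ∧
      (∀ x, (∃ y, F.rel x y) ∨ ∃ y, F.rel y x) ∧ ¬ F.Validates φ := by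
  have h : imp nonIsolated φ ∉ K4t := fun h =>
    hφ (isTenseLogic_K4s.mp _ _ nonIsolated_mem_K4s (K4t_subset_K4s h))
  obtain ⟨F, hfin, hF, V, x, hx⟩ := exists_finite_countermodel_of_notMem_K4t.{u} h
  rw [mem_truth_imp, Classical.not_imp] at hx
  exact exists_nonIsolated_model hF hx.2 hx.1

/-- The isolated irreflexive point. -/
def isolatedPoint : Frame.{u} := ⟨PUnit, ⟨PUnit.unit⟩, fun _ _ => False⟩

theorem truth_of_isolated {F : Frame.{u}} {V : ℕ → Set F.carrier} {x : F.carrier}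
    (hx : x ∉ F.truth V nonIsolated) {φ : Formula} (h : isolatedPoint.{v}.Validates φ) :
    x ∈ F.truth V φ := by
  rw [mem_truth_nonIsolated, not_or] at hx
  have key : ∀ (ψ : Formula) (a : isolatedPoint.{v}.carrier),
      a ∈ isolatedPoint.{v}.truth (fun n => {_a | x ∈ V n}) ψ ↔ x ∈ F.truth V ψ := by
    intro ψ a
    induction ψ with
    | var n => exact Iff.rfl
    | bot => exact Iff.rfl
    | imp ψ χ h₁ h₂ => rw [mem_truth_imp, mem_truth_imp, h₁, h₂]
    | box ψ ih => exact ⟨fun _ y hy => absurd ⟨y, hy⟩ hx.1, fun _ y hy => hy.elim⟩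
    | bdia ψ ih =>
      exact ⟨fun ⟨_, h, _⟩ => h.elim, fun ⟨y, hy, _⟩ => absurd ⟨y, hy⟩ hx.2⟩
  exact (key φ PUnit.unit).1 (h _ _)

/-- A point refuting `φ` is either isolated, hence a copy of `isolatedPoint`, or survives the
deletion of isolated points. -/
theorem mem_K4t_of_mem_K4s {φ : Formula} (h : φ ∈ K4s) (h' : isolatedPoint.{u}.Validates φ) :
    φ ∈ K4t := by
  by_contra hφ
  obtain ⟨F, hfin, hF, V, x, hx⟩ := exists_finite_countermodel_of_notMem_K4t.{0} hφ
  by_cases hxi : x ∈ F.truth V nonIsolated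
  · obtain ⟨F', -, hF', hi, hF'φ⟩ := exists_nonIsolated_model hF hx hxi
    exact hF'φ (validates_of_mem_K4s hF' hi h)
  · exact hx (truth_of_isolated hxi h')

theorem isolatedPoint_mem_FinFr_K4t : isolatedPoint.{u} ∈ FinFr.{u} K4t :=
  ⟨inferInstanceAs (Finite PUnit), fun _ h =>
    validates_of_mem_K4t (fun _ _ _ h _ => False.elim h) h⟩

/-- Replacing variables by `⊤` and `⊥` turns a formula of `L` refuted at the isolated point into one
false at every isolated point. By completeness it implies `nonIsolated` in `K4t`, which puts
`nonIsolated` into `L`. -/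
theorem isolatedPoint_mem_FinFr {L : Set Formula} (hL : L ∈ NExt K4t)
    (h : nonIsolated ∉ L) : isolatedPoint.{u} ∈ FinFr.{u} L := by
  classical
  refine ⟨inferInstanceAs (Finite PUnit), fun φ hφ => ?_⟩
  by_contra hv
  simp only [Frame.Validates, not_forall] at hv
  obtain ⟨V, x, hx⟩ := hv
  let s : ℕ → Formula := fun n => if x ∈ V n then top else bot
  have hs : ∀ (W : ℕ → Set isolatedPoint.{u}.carrier) n,
      isolatedPoint.{u}.truth W (s n) = V n := by
    intro W n
    ext y
    obtain rfl : x = y := Subsingleton.elim (α := PUnit) x y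
    by_cases hn : x ∈ V n
    · simp only [s, if_pos hn, hn, iff_true]
      exact mem_truth_top _ _
    · simp only [s, if_neg hn, hn, iff_false]
      exact not_mem_truth_bot _ _
  have hneg : isolatedPoint.{u}.Validates (neg (φ.subst s)) := by
    intro W y
    obtain rfl : x = y := Subsingleton.elim (α := PUnit) x y
    rw [mem_truth_neg, truth_subst]
    simpa only [hs] using hx
  refine h (hL.1.mp _ _ (hL.1.subst s φ hφ) (hL.2 ?_))
  by_contra hcon
  obtain ⟨F, -, -, W, y, hy⟩ := exists_finite_countermodel_of_notMem_K4t.{0} hcon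
  rw [mem_truth_imp, Classical.not_imp] at hy
  exact (mem_truth_neg F W).1 (truth_of_isolated hy.2 hneg) hy.1

theorem isolatedPoint_notMem_FinFr_K4s : isolatedPoint.{u} ∉ FinFr.{u} K4s := fun h => by
  rcases (mem_truth_nonIsolated _ _).1 (h.2 _ nonIsolated_mem_K4s (fun _ => ∅) PUnit.unit) with
    ⟨_, h⟩ | ⟨_, h⟩ <;> exact h

/-! ### Logics below `K4s` are determined by their finite frames. -/

theorem eq_or_eq_of_subset_K4s {L : Set Formula} (hL : L ∈ NExt K4t) (h : L ⊆ K4s) :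
    L = K4t ∨ L = K4s := by
  by_cases hi : nonIsolated ∈ L
  · exact Or.inr (h.antisymm (K4s_subset hL hi))
  · exact Or.inl (Set.Subset.antisymm (fun φ hφ => mem_K4t_of_mem_K4s (h hφ)
      ((isolatedPoint_mem_FinFr.{0} hL hi).2 φ hφ)) hL.2)

/-- The finite frames that characterise `K4s` validate `L`, hence also `L'`. -/
theorem subset_K4s_of_FinFr_eq {L L' : Set Formula} (h : L ⊆ K4s)
    (hFin : FinFr.{u} L' = FinFr.{u} L) : L' ⊆ K4s := by
  intro φ hφ
  by_contra hφ'
  obtain ⟨F, hfin, hF, hi, hFφ⟩ := exists_finite_countermodel_of_notMem_K4s.{u} hφ'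
  have : F ∈ FinFr.{u} L' := hFin ▸ ⟨hfin, fun ψ hψ => validates_of_mem_K4s hF hi (h hψ)⟩
  exact hFφ (this.2 φ hφ)

theorem eq_of_FinFr_eq {L L' : Set Formula} (hL : L ∈ NExt K4t) (h : L ⊆ K4s)
    (hL' : L' ∈ NExt K4t) (hFin : FinFr.{u} L' = FinFr.{u} L) : L' = L := by
  have hne : FinFr.{u} K4t ≠ FinFr.{u} K4s := fun he =>
    isolatedPoint_notMem_FinFr_K4s.{u} (he ▸ isolatedPoint_mem_FinFr_K4t)
  rcases eq_or_eq_of_subset_K4s hL h with rfl | rfl <;>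
    rcases eq_or_eq_of_subset_K4s hL' (subset_K4s_of_FinFr_eq h hFin) with rfl | rfl
  · rfl
  · exact absurd hFin.symm hne
  · exact absurd hFin hne
  · rfl

theorem Fr_eq_imp_FinFr_eq {L L' : Set Formula} (h : Fr.{u} L' = Fr.{u} L) :
    FinFr.{u} L' = FinFr.{u} L := by
  ext F
  exact and_congr_right fun _ => Set.ext_iff.1 h F

/-! ### Frames without Kripke semantics -/

/-- The order of the fence `0 < 1 > 2 < 3 > …`. -/
def FenceLE (i j : ℕ) : Prop := i = j ∨ (i % 2 = 0 ∧ (j = i + 1 ∨ i = j + 1))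

/-- The points of `towerFrame`. -/
inductive TowerPoint (X : Type u) (n : ℕ) : Type u
  | base (x : X) (i : Fin (n + 1))
  | chain (j : ℕ)
  | spike (i : ℕ)

/-- The accessibility relation of `towerFrame`. -/
def TowerRel (F : Frame.{u}) (n : ℕ) (I : Set ℕ) :
    TowerPoint F.carrier n → TowerPoint F.carrier n → Prop
  | .base x i, .base y j => F.rel x y ∧ FenceLE i j
  | .base _ i, .chain j => i.1 = 0 ∧ j = 0
  | .chain i, .chain j => j < i
  | .spike i, .chain j => j = 0 ∨ (j ≤ i ∧ i ∈ I)
  | _, _ => False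

/-- The product of `F` with a fence, whose lowest level sees the last point of an infinite
descending chain. Each `i` in `I` is coded by an initial point of depth `i + 1`. -/
abbrev towerFrame (F : Frame.{u}) (n : ℕ) (I : Set ℕ) : Frame.{u} :=
  ⟨TowerPoint F.carrier n, ⟨.chain 0⟩, TowerRel F n I⟩

/-- The sets whose trace on the chain is finite or cofinite. -/
def towerSets (F : Frame.{u}) (n : ℕ) (I : Set ℕ) : Set (Set (towerFrame F n I).carrier) :=
  {A | (∀ᶠ j in atTop, TowerPoint.chain j ∈ A) ∨ ∀ᶠ j in atTop, TowerPoint.chain j ∉ A}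

def towerLogic (F : Frame.{u}) (n : ℕ) (I : Set ℕ) : Set Formula :=
  logicOf (towerFrame F n I) (towerSets F n I)

section Tower

variable (F : Frame.{u}) (n : ℕ) (I : Set ℕ)

/-- Level 0 is even, so only level 0 sees it in the fence, and no other level needs to see the
chain. -/
theorem towerFrame_trans (hF : ∀ x y z, F.rel x y → F.rel y z → F.rel x z) :
    ∀ x y z, (towerFrame F n I).rel x y → (towerFrame F n I).rel y z →
      (towerFrame F n I).rel x z := by
  change ∀ x y z, TowerRel F n I x y → TowerRel F n I y z → TowerRel F n I x z
  rintro (⟨x, i⟩ | i | i) (⟨y, j⟩ | j | j) (⟨z, k⟩ | k | k) h h' <;>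
    simp only [TowerRel, FenceLE] at h h' ⊢
  · obtain ⟨h₁, h₂⟩ := h
    obtain ⟨h₃, h₄⟩ := h'
    exact ⟨hF _ _ _ h₁ h₃, by omega⟩
  · obtain ⟨-, h₂⟩ := h
    omega
  · omega
  · omega
  · rcases h with rfl | ⟨h, hi⟩
    · omega
    · exact Or.inr ⟨h'.le.trans h, hi⟩

/-- Along the chain successor sets grow and, from point 1 on, predecessor sets shrink. So `□` and
`⧫` of any set at all have a finite or cofinite trace. -/
theorem tower_admissible : Admissible (towerFrame F n I) (towerSets F n I) where
  empty := Or.inr (Eventually.of_forall fun _ h => h)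
  imp := by
    rintro A hA B hB
    rcases hB with hB | hB
    · exact Or.inl (hB.mono fun j hj => Or.inr hj)
    rcases hA with hA | hA
    · exact Or.inr ((hA.and hB).mono fun j hj h => h.elim (fun h => h hj.1) hj.2)
    · exact Or.inl (hA.mono fun j hj => Or.inl hj)
  box := by
    intro A _
    by_cases h : ∀ j, TowerPoint.chain j ∈ A
    · refine Or.inl (Eventually.of_forall fun j => ?_)
      rintro (⟨y, k⟩ | k | k) hk
      exacts [hk.elim, h k, hk.elim]
    · push Not at h
      obtain ⟨j, hj⟩ := h
      refine Or.inr ?_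
      filter_upwards [eventually_gt_atTop j] with k hk h
      exact hj (h (.chain j) hk)
  bdia := by
    intro A _
    -- Point 0 is left out because level 0 of the base and all spikes see it.
    by_cases h : ∀ j, 1 ≤ j → ∃ y ∈ A, TowerRel F n I y (.chain j)
    · refine Or.inl ?_
      filter_upwards [eventually_ge_atTop 1] with j hj
      obtain ⟨y, hy, hyj⟩ := h j hj
      exact ⟨y, hyj, hy⟩
    · push Not at h
      obtain ⟨j, hj, h⟩ := h
      refine Or.inr ?_
      filter_upwards [eventually_ge_atTop j] with k hk
      rintro ⟨y, hy, hyA⟩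
      refine h y hyA ?_
      change TowerRel F n I y _ at hy
      rcases y with ⟨y, i⟩ | i | i
      · exact absurd hy.2 (by omega)
      · exact lt_of_le_of_lt hk hy
      · rcases hy with rfl | ⟨hy, hi⟩
        · omega
        · exact Or.inr ⟨hk.trans hy, hi⟩

theorem isTenseLogic_towerLogic : IsTenseLogic (towerLogic F n I) :=
  (tower_admissible F n I).isTenseLogic

variable {F n I}

/-- Two steps lower the level by one. If the available edge of `F` goes against the fence, a first
step within the level reverses it. This is where isolated points must be excluded. -/
theorem reach_base (hi : ∀ x, (∃ y, F.rel x y) ∨ ∃ y, F.rel y x) (k : ℕ) (hk : k < n + 1)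
    (x : F.carrier) :
    (towerFrame F n I).Reach (2 * k + 1) (.base x ⟨k, hk⟩) (.chain 0) := by
  induction k generalizing x with
  | zero => exact ⟨.chain 0, Or.inr (Or.inl ⟨rfl, rfl⟩), rfl⟩
  | succ k ih =>
    have step : ∃ (p : TowerPoint F.carrier n) (y : F.carrier),
        (TowerRel F n I (.base x ⟨k + 1, hk⟩) p ∨ TowerRel F n I p (.base x ⟨k + 1, hk⟩)) ∧
        (TowerRel F n I p (.base y ⟨k, by omega⟩) ∨
          TowerRel F n I (.base y ⟨k, by omega⟩) p) := by
      rcases Nat.mod_two_eq_zero_or_one k with h | h <;> rcases hi x with ⟨y, hy⟩ | ⟨y, hy⟩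
      · refine ⟨.base y ⟨k + 1, hk⟩, x, Or.inl ⟨hy, Or.inl rfl⟩, Or.inr ⟨hy, Or.inr ⟨h, ?_⟩⟩⟩
        exact Or.inl rfl
      · refine ⟨.base y ⟨k, by omega⟩, x, Or.inr ⟨hy, Or.inr ⟨h, Or.inl rfl⟩⟩,
          Or.inl ⟨hy, Or.inl rfl⟩⟩
      · refine ⟨.base y ⟨k, by omega⟩, x, Or.inl ⟨hy, Or.inr ⟨?_, Or.inr rfl⟩⟩,
          Or.inr ⟨hy, Or.inl rfl⟩⟩
        simp only; omega
      · refine ⟨.base y ⟨k + 1, hk⟩, x, Or.inr ⟨hy, Or.inl rfl⟩,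
          Or.inl ⟨hy, Or.inr ⟨?_, Or.inr rfl⟩⟩⟩
        simp only; omega
    obtain ⟨p, y, h₁, h₂⟩ := step
    exact ⟨p, Or.inr h₁, .base y ⟨k, by omega⟩, Or.inr h₂, ih (by omega) y⟩

theorem reach_chain_zero (hi : ∀ x, (∃ y, F.rel x y) ∨ ∃ y, F.rel y x)
    (p : (towerFrame F n I).carrier) : (towerFrame F n I).Reach (2 * n + 1) p (.chain 0) := by
  rcases p with ⟨x, k, hk⟩ | j | i
  · exact (reach_base hi k hk x).mono (by omega)
  · refine Frame.Reach.mono (n := 1) (by omega) ⟨.chain 0, ?_, rfl⟩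
    rcases Nat.eq_zero_or_pos j with rfl | hj
    exacts [Or.inl rfl, Or.inr (Or.inl hj)]
  · exact Frame.Reach.mono (n := 1) (by omega) ⟨.chain 0, Or.inr (Or.inl (Or.inl rfl)), rfl⟩

theorem reach_of_rel_chain_zero (hi : ∀ x, (∃ y, F.rel x y) ∨ ∃ y, F.rel y x)
    (p : (towerFrame F n I).carrier) {q : (towerFrame F n I).carrier}
    (hq : TowerRel F n I q (.chain 0)) : (towerFrame F n I).Reach (2 * n + 2) p q :=
  (reach_chain_zero hi p).snoc (Or.inr (Or.inr hq))

variable (V : ℕ → Set (towerFrame F n I).carrier)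

/-! ### Depths of points in the tower. -/

theorem chain_mem_depthLT {j k : ℕ} :
    (TowerPoint.chain j) ∈ (towerFrame F n I).truth V (depthLT k) ↔ j < k := by
  induction k generalizing j with
  | zero => exact (iff_false_right (Nat.not_lt_zero j)).2 (not_mem_truth_bot _ V)
  | succ k ih =>
    rw [mem_truth_depthLT_succ]
    constructor
    · intro h
      by_contra hj
      exact lt_irrefl k (ih.1 (h (.chain k) (show k < j by omega)))
    · rintro h (⟨y, i⟩ | i | i) hi
      · exact hi.elim
      · exact ih.2 (lt_of_lt_of_le (show i < j from hi) (by omega))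
      · exact hi.elim

theorem chain_mem_depthEq {j k : ℕ} :
    (TowerPoint.chain j) ∈ (towerFrame F n I).truth V (depthEq k) ↔ j = k := by
  rw [mem_truth_depthEq, chain_mem_depthLT, chain_mem_depthLT]
  omega

theorem spike_mem_depthLT_succ {i k : ℕ} :
    (TowerPoint.spike i) ∈ (towerFrame F n I).truth V (depthLT (k + 1)) ↔
      0 < k ∧ (i ∈ I → i < k) := by
  rw [mem_truth_depthLT_succ]
  constructor
  · exact fun h => ⟨(chain_mem_depthLT V).1 (h (.chain 0) (Or.inl rfl)),
      fun hi => (chain_mem_depthLT V).1 (h (.chain i) (Or.inr ⟨le_rfl, hi⟩))⟩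
  · rintro ⟨h, h'⟩ (⟨y, j⟩ | j | j) hj
    · exact hj.elim
    · refine (chain_mem_depthLT V).2 ?_
      rcases hj with rfl | ⟨hj, hi⟩
      exacts [h, lt_of_le_of_lt hj (h' hi)]
    · exact hj.elim

/-- Spikes outside `I` all have depth 1, so only depths of at least 2 carry information; hence `1 ≤
k`. -/
theorem spike_mem_depthEq {i k : ℕ} (hk : 1 ≤ k) :
    (TowerPoint.spike i) ∈ (towerFrame F n I).truth V (depthEq (k + 1)) ↔ i = k ∧ i ∈ I := by
  rw [mem_truth_depthEq, spike_mem_depthLT_succ, spike_mem_depthLT_succ]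
  by_cases hi : i ∈ I <;> simp only [hi] <;> simp <;> omega

/-- No base point sees a spike, so its depth is independent of `I`, and one bound serves all towers.
-/
theorem base_mem_depthLT_iff {J : Set ℕ} (W : ℕ → Set (towerFrame F n J).carrier) (k : ℕ)
    (x : F.carrier) (i : Fin (n + 1)) :
    (TowerPoint.base x i) ∈ (towerFrame F n I).truth V (depthLT k) ↔
      (TowerPoint.base x i) ∈ (towerFrame F n J).truth W (depthLT k) := by
  induction k generalizing x i with
  | zero => exact Iff.rfl
  | succ k ih =>
    rw [mem_truth_depthLT_succ, mem_truth_depthLT_succ]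
    refine forall_congr' ?_
    rintro (⟨y, j⟩ | j | j)
    · exact imp_congr Iff.rfl (ih y j)
    · exact imp_congr Iff.rfl ((chain_mem_depthLT V).trans (chain_mem_depthLT W).symm)
    · exact ⟨fun _ h => False.elim h, fun _ h => False.elim h⟩

/-- Each of the finitely many base points has at most one finite depth. -/
theorem exists_depth_bound (F : Frame.{u}) [Finite F.carrier] (n : ℕ) :
    ∃ K, 1 ≤ K ∧ ∀ (I : Set ℕ) (V : ℕ → Set (towerFrame F n I).carrier) (k : ℕ), K ≤ k →
      ∀ (x : F.carrier) (i : Fin (n + 1)),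
        TowerPoint.base x i ∉ (towerFrame F n I).truth V (depthEq k) := by
  have h : ∀ p : F.carrier × Fin (n + 1), ∃ K, ∀ k, K ≤ k →
      TowerPoint.base p.1 p.2 ∉ (towerFrame F n ∅).truth (fun _ => ∅) (depthEq k) := by
    intro p
    by_cases h : ∃ k, TowerPoint.base p.1 p.2 ∈
      (towerFrame F n ∅).truth (fun _ => ∅) (depthEq k)
    · obtain ⟨k, hk⟩ := h
      refine ⟨k + 1, fun m hm h => ?_⟩
      have := depthEq_unique _ _ hk h
      omega
    · push Not at h
      exact ⟨0, fun k _ => h k⟩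
  choose K hK using h
  obtain ⟨M, hM⟩ := Set.finite_range K |>.bddAbove
  refine ⟨M + 1, by omega, fun I V k hk x i h => ?_⟩
  refine hK (x, i) k ((hM ⟨(x, i), rfl⟩).trans (by omega)) ?_
  rw [mem_truth_depthEq] at h ⊢
  rwa [base_mem_depthLT_iff V (fun _ => ∅), base_mem_depthLT_iff V (fun _ => ∅)] at h

/-- Projection to `F` preserves edges in both directions, the same level lifts them back, and a
formula of depth at most `i` cannot look from level `i` past level 0. -/
theorem base_mem_truth_iff (W : ℕ → Set F.carrier) (ψ : Formula) (x : F.carrier)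
    (i : Fin (n + 1)) (h : ψ.depth ≤ i.1) :
    (TowerPoint.base x i) ∈ (towerFrame F n I).truth
      (fun m => {p | ∃ y ∈ W m, ∃ j, p = TowerPoint.base y j}) ψ ↔ x ∈ F.truth W ψ := by
  induction ψ generalizing x i with
  | var m =>
    constructor
    · rintro ⟨y, hy, j, hj⟩
      cases hj
      exact hy
    · exact fun h => ⟨x, h, i, rfl⟩
  | bot => exact Iff.rfl
  | imp φ ψ h₁ h₂ =>
    rw [mem_truth_imp, mem_truth_imp, h₁ x i ((le_max_left _ _).trans h),
      h₂ x i ((le_max_right _ _).trans h)]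
  | box ψ ih =>
    have h : ψ.depth + 1 ≤ i.1 := h
    refine ⟨fun h' y hy => (ih y i (by omega)).1 (h' (.base y i) ⟨hy, Or.inl rfl⟩), ?_⟩
    rintro h' (⟨y, j⟩ | j | j) hj
    · obtain ⟨hj₁, hj₂⟩ : F.rel x y ∧ FenceLE i j := hj
      exact (ih y j (by unfold FenceLE at hj₂; omega)).2 (h' y hj₁)
    · have : i.1 = 0 ∧ j = 0 := hj
      omega
    · exact hj.elim
  | bdia ψ ih =>
    have h : ψ.depth + 1 ≤ i.1 := h
    refine ⟨?_, fun ⟨y, hy, h'⟩ => ⟨.base y i, ⟨hy, Or.inl rfl⟩, (ih y i (by omega)).2 h'⟩⟩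
    rintro ⟨⟨y, j⟩ | j | j, hj, h'⟩
    · obtain ⟨hj₁, hj₂⟩ : F.rel y x ∧ FenceLE j i := hj
      exact ⟨y, hj₁, (ih y j (by unfold FenceLE at hj₂; omega)).1 h'⟩
    · exact hj.elim
    · exact hj.elim

end Tower

/-! ### Formulas that are valid in the towers -/

/-- Along the predecessors of a point of depth `K`, two formulas cannot be disjoint and each
be followed backwards by the other one. -/
def alternation (K : ℕ) (r s : Formula) : Formula :=
  imp (innerDepth K) (imp r (imp (and (imp r (bdia s)) (bbox (imp r (bdia s))))
    (imp (and (imp s (bdia r)) (bbox (imp s (bdia r)))) (bdia (and r s)))))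

theorem mem_truth_alternation (F : Frame.{u}) (V : ℕ → Set F.carrier) {x : F.carrier} {K : ℕ}
    {r s : Formula} : x ∈ F.truth V (alternation K r s) ↔
      (x ∈ F.truth V (innerDepth K) → x ∈ F.truth V r →
        (x ∈ F.truth V (imp r (bdia s)) ∧ ∀ y, F.rel y x → y ∈ F.truth V (imp r (bdia s))) →
        (x ∈ F.truth V (imp s (bdia r)) ∧ ∀ y, F.rel y x → y ∈ F.truth V (imp s (bdia r))) →
        ∃ y, F.rel y x ∧ y ∈ F.truth V r ∧ y ∈ F.truth V s) := by
  refine (mem_truth_imp F V).trans <| imp_congr Iff.rfl <| (mem_truth_imp F V).trans <|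
    imp_congr Iff.rfl <| (mem_truth_imp F V).trans <| imp_congr ((mem_truth_and F V).trans
    (and_congr Iff.rfl (mem_truth_bbox F V))) <| (mem_truth_imp F V).trans <|
    imp_congr ((mem_truth_and F V).trans (and_congr Iff.rfl (mem_truth_bbox F V))) <|
    exists_congr fun y => and_congr Iff.rfl (mem_truth_and F V)

section Tower

variable {F : Frame.{u}} {n K : ℕ} {I : Set ℕ}

/-- From depth `K` on only chain points and spikes remain, and spikes have no predecessor. -/
theorem innerDepth_mem_iff (hK : ∀ (V : ℕ → Set (towerFrame F n I).carrier) (k : ℕ), K ≤ k →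
      ∀ (x : F.carrier) (i : Fin (n + 1)),
        TowerPoint.base x i ∉ (towerFrame F n I).truth V (depthEq k))
    (V : ℕ → Set (towerFrame F n I).carrier) {k : ℕ} (hk : K ≤ k)
    (p : (towerFrame F n I).carrier) :
    p ∈ (towerFrame F n I).truth V (innerDepth k) ↔ p = TowerPoint.chain k := by
  rw [mem_truth_innerDepth]
  constructor
  · rintro ⟨h, q, hq⟩
    change TowerRel F n I q p at hq
    rcases p with ⟨x, i⟩ | j | i
    · exact absurd h (hK V k hk x i)
    · rw [(chain_mem_depthEq V).1 h]
    · rcases q with ⟨x, i⟩ | j | i <;> exact hq.elim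
  · rintro rfl
    exact ⟨(chain_mem_depthEq V).2 rfl, .chain (k + 1), Nat.lt_succ_self k⟩

theorem within_innerDepth_mem (hi : ∀ x, (∃ y, F.rel x y) ∨ ∃ y, F.rel y x) (hK1 : 1 ≤ K) :
    within (2 * n + 2) (innerDepth K) ∈ towerLogic F n I := by
  intro V _ p
  rw [mem_truth_within]
  refine ⟨.chain K, reach_of_rel_chain_zero hi p hK1, ?_⟩
  rw [mem_truth_innerDepth]
  exact ⟨(chain_mem_depthEq V).2 rfl, .chain (K + 1), Nat.lt_succ_self K⟩

theorem innerDepth_succ_mem (hK : ∀ (V : ℕ → Set (towerFrame F n I).carrier) (k : ℕ), K ≤ k →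
      ∀ (x : F.carrier) (i : Fin (n + 1)),
        TowerPoint.base x i ∉ (towerFrame F n I).truth V (depthEq k)) {k : ℕ} (hk : K ≤ k) :
    imp (innerDepth k) (bdia (innerDepth (k + 1))) ∈ towerLogic F n I := by
  intro V _ p
  rw [mem_truth_imp, innerDepth_mem_iff hK V hk, mem_truth_bdia]
  rintro rfl
  exact ⟨.chain (k + 1), Nat.lt_succ_self k, (innerDepth_mem_iff hK V (by omega) _).2 rfl⟩

/-- The hypotheses make `r` and `s` both recur unboundedly along the chain. Being admissible, both
are cofinite there, so they meet. -/
theorem alternation_mem (hK : ∀ (V : ℕ → Set (towerFrame F n I).carrier) (k : ℕ), K ≤ k →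
      ∀ (x : F.carrier) (i : Fin (n + 1)),
        TowerPoint.base x i ∉ (towerFrame F n I).truth V (depthEq k)) (hK1 : 1 ≤ K)
    (r s : Formula) : alternation K r s ∈ towerLogic F n I := by
  intro V hV p
  have hr := (tower_admissible F n I).truth_mem hV r
  have hs := (tower_admissible F n I).truth_mem hV s
  rw [mem_truth_alternation, innerDepth_mem_iff hK V le_rfl]
  rintro rfl hrK ⟨hr₀, hr₁⟩ ⟨hs₀, hs₁⟩
  have hspike : ∀ i (A : Set (towerFrame F n I).carrier),
      ¬ ∃ q, TowerRel F n I q (.spike i) ∧ q ∈ A := by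
    rintro i A ⟨⟨x, j⟩ | j | j, h, -⟩ <;> exact h
  have step : ∀ {φ ψ : Formula},
      (TowerPoint.chain K) ∈ (towerFrame F n I).truth V (imp φ (bdia ψ)) →
      (∀ q, TowerRel F n I q (.chain K) →
        q ∈ (towerFrame F n I).truth V (imp φ (bdia ψ))) →
      (∀ q, TowerRel F n I q (.chain K) →
        q ∈ (towerFrame F n I).truth V (imp ψ (bdia φ))) →
      ∀ j, K ≤ j → (TowerPoint.chain j) ∈ (towerFrame F n I).truth V φ →
        ∃ k, j < k ∧ (TowerPoint.chain k) ∈ (towerFrame F n I).truth V ψ := by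
    intro φ ψ h₀ h₁ h₂ j hj hφ
    obtain ⟨q, hq, hqψ⟩ : (TowerPoint.chain j) ∈ (towerFrame F n I).truth V (bdia ψ) := by
      rcases hj.eq_or_lt with rfl | hj
      exacts [(mem_truth_imp _ V).1 h₀ hφ, (mem_truth_imp _ V).1 (h₁ _ hj) hφ]
    change TowerRel F n I q _ at hq
    rcases q with ⟨x, i⟩ | k | i
    · exact absurd hq.2 (by omega)
    · exact ⟨k, hq, hqψ⟩
    -- The alternation cannot escape to a spike: it would demand a predecessor there.
    · refine absurd ((mem_truth_imp _ V).1 (h₂ (.spike i) ?_) hqψ) (hspike i _)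
      rcases hq with rfl | ⟨hq, hi⟩
      · omega
      · exact Or.inr ⟨hj.trans hq, hi⟩
  have hrs := step hr₀ hr₁ hs₁
  have hsr := step hs₀ hs₁ hr₁
  have hrf : ∀ m, ∃ j, K ≤ j ∧ m ≤ j ∧
      (TowerPoint.chain j) ∈ (towerFrame F n I).truth V r := by
    intro m
    induction m with
    | zero => exact ⟨K, le_rfl, Nat.zero_le _, hrK⟩
    | succ m ih =>
      obtain ⟨j, hj, hmj, hjr⟩ := ih
      obtain ⟨k, hk, hks⟩ := hrs j hj hjr
      obtain ⟨l, hl, hlr⟩ := hsr k (by omega) hks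
      exact ⟨l, by omega, by omega, hlr⟩
  have hr' : ∀ᶠ j in atTop, (TowerPoint.chain j) ∈ (towerFrame F n I).truth V r := by
    refine hr.resolve_right fun h => ?_
    obtain ⟨m, hm⟩ := eventually_atTop.1 h
    obtain ⟨j, -, hmj, hj⟩ := hrf m
    exact hm j hmj hj
  have hs' : ∀ᶠ j in atTop, (TowerPoint.chain j) ∈ (towerFrame F n I).truth V s := by
    refine hs.resolve_right fun h => ?_
    obtain ⟨m, hm⟩ := eventually_atTop.1 h
    obtain ⟨j, hKj, hmj, hj⟩ := hrf m
    obtain ⟨k, hk, hks⟩ := hrs j hKj hj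
    exact hm k (by omega) hks
  obtain ⟨j, hj, hjr, hjs⟩ := ((eventually_gt_atTop K).and (hr'.and hs')).exists
  exact ⟨.chain j, hj, hjr, hjs⟩

theorem within_initialDepth_mem (hi : ∀ x, (∃ y, F.rel x y) ∨ ∃ y, F.rel y x) {k : ℕ}
    (hk : 1 ≤ k) (hkI : k ∈ I) :
    within (2 * n + 2) (initialDepth (k + 1)) ∈ towerLogic F n I := by
  intro V _ p
  rw [mem_truth_within]
  refine ⟨.spike k, reach_of_rel_chain_zero hi p (Or.inl rfl), ?_⟩
  rw [mem_truth_initialDepth]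
  refine ⟨(spike_mem_depthEq V hk).2 ⟨rfl, hkI⟩, ?_⟩
  rintro ⟨⟨x, j⟩ | j | j, h⟩ <;> exact h

theorem not_mem_initialDepth (hK : ∀ (V : ℕ → Set (towerFrame F n I).carrier) (k : ℕ), K ≤ k →
      ∀ (x : F.carrier) (i : Fin (n + 1)),
        TowerPoint.base x i ∉ (towerFrame F n I).truth V (depthEq k)) (hK1 : 1 ≤ K) {k : ℕ}
    (hk : K ≤ k) (hkI : k ∉ I) (V : ℕ → Set (towerFrame F n I).carrier)
    (p : (towerFrame F n I).carrier) :
    p ∉ (towerFrame F n I).truth V (initialDepth (k + 1)) := by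
  rw [mem_truth_initialDepth]
  rintro ⟨h, h'⟩
  rcases p with ⟨x, i⟩ | j | i
  · exact hK V (k + 1) (by omega) x i h
  · exact h' ⟨.chain (j + 1), Nat.lt_succ_self j⟩
  · obtain ⟨rfl, hi⟩ := (spike_mem_depthEq V (hK1.trans hk)).1 h
    exact hkI hi

end Tower

/-! ### Intersections with logics of towers -/

theorem or_mem_inter {L L' : Set Formula} (hL : IsTenseLogic L) (hL' : IsTenseLogic L')
    {φ ψ : Formula} (hφ : φ ∈ L) (hψ : ψ ∈ L') : or φ ψ ∈ L ∩ L' :=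
  ⟨hL.mp _ _ hφ (hL.taut _ fun v hb hi => by simp only [hi]; tauto),
    hL'.mp _ _ hψ (hL'.taut _ fun v hb hi => by simp only [hi]; tauto)⟩

/-- Used to spread what is known at a single point over a neighbourhood of it. -/
theorem logicOf_throughout {F : Frame.{u}} {𝒜 : Set (Set F.carrier)} {φ : Formula}
    (h : φ ∈ logicOf F 𝒜) (n : ℕ) : throughout n φ ∈ logicOf F 𝒜 := fun V hV _ =>
  (mem_truth_throughout F V).2 fun y _ => h V hV y

/-- Frames of `L ∩ L'` are frames of `L`, if `L'` is the logic of a tower. -/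
theorem Fr_inter_towerLogic {F : Frame.{v}} {n K : ℕ} {I : Set ℕ}
    (hi : ∀ x, (∃ y, F.rel x y) ∨ ∃ y, F.rel y x)
    (hK : ∀ (V : ℕ → Set (towerFrame F n I).carrier) (k : ℕ), K ≤ k →
      ∀ (x : F.carrier) (i : Fin (n + 1)),
        TowerPoint.base x i ∉ (towerFrame F n I).truth V (depthEq k)) (hK1 : 1 ≤ K)
    {L : Set Formula} (hL : IsTenseLogic L) :
    Fr.{u} (L ∩ towerLogic F n I) = Fr.{u} L := by
  refine Set.Subset.antisymm (fun G hG φ hφ V x => ?_) fun G hG φ hφ => hG φ hφ.1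
  by_contra hx
  let N := 2 * n + 2
  let m := φ.varBound
  -- Two variables fresh for `φ` mark the even and odd offsets of depth from `K`. Infinite unions
  -- are allowed since `G` is a Kripke frame.
  let W : ℕ → Set G.carrier := fun k =>
    if k = m then {y | ∃ i, y ∈ G.truth V (innerDepth (K + 2 * i))}
    else if k = m + 1 then {y | ∃ i, y ∈ G.truth V (innerDepth (K + 2 * i + 1))}
    else V k
  have hWφ : x ∉ G.truth W φ := by
    rwa [truth_congr G (W := V)]
    intro k hk
    have h₁ : k ≠ m := hk.ne
    have h₂ : k ≠ m + 1 := by omega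
    simp only [W, if_neg h₁, if_neg h₂]
  have hr : G.truth W (var m) = {y | ∃ i, y ∈ G.truth V (innerDepth (K + 2 * i))} := by
    simp [Frame.truth, W]
  have hs : G.truth W (var (m + 1)) =
      {y | ∃ i, y ∈ G.truth V (innerDepth (K + 2 * i + 1))} := by
    simp [Frame.truth, W]
  have hloc : ∀ ψ ∈ towerLogic F n I, x ∈ G.truth W ψ := fun ψ hψ =>
    ((mem_truth_or G W).1 (hG _ (or_mem_inter hL (isTenseLogic_towerLogic F n I) hφ hψ) W
      x)).resolve_left hWφ
  obtain ⟨y, hxy, hy⟩ := (mem_truth_within G W).1 (hloc _ (within_innerDepth_mem hi hK1))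
  -- The point `y` lies within `N` steps; the extra step covers its predecessors, as `alternation`
  -- requires.
  have hstep : ∀ z, G.Reach (N + 1) x z → ∀ k, K ≤ k → z ∈ G.truth V (innerDepth k) →
      ∃ w, G.rel w z ∧ w ∈ G.truth V (innerDepth (k + 1)) := by
    intro z hz k hk hzk
    have h := (mem_truth_imp G W).1 ((mem_truth_throughout G W).1 (hloc _ (logicOf_throughout
      (innerDepth_succ_mem hK hk) (N + 1))) z hz)
    rw [truth_innerDepth_congr G W V, mem_truth_bdia, truth_innerDepth_congr G W V] at h
    exact h hzk
  have hrs : ∀ z, G.Reach (N + 1) x z → z ∈ G.truth W (imp (var m) (bdia (var (m + 1)))) := by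
    intro z hz
    rw [mem_truth_imp, mem_truth_bdia, hr, hs]
    rintro ⟨i, h⟩
    obtain ⟨w, hw, hw'⟩ := hstep z hz _ (by omega) h
    exact ⟨w, hw, i, hw'⟩
  have hsr : ∀ z, G.Reach (N + 1) x z → z ∈ G.truth W (imp (var (m + 1)) (bdia (var m))) := by
    intro z hz
    rw [mem_truth_imp, mem_truth_bdia, hr, hs]
    rintro ⟨i, h⟩
    obtain ⟨w, hw, hw'⟩ := hstep z hz _ (by omega) h
    exact ⟨w, hw, i + 1, hw'⟩
  have halt := (mem_truth_throughout G W).1 (hloc _ (logicOf_throughout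
    (alternation_mem hK hK1 (var m) (var (m + 1))) N)) y hxy
  rw [mem_truth_alternation] at halt
  -- The resulting `z` would have two depths of different parity.
  obtain ⟨z, -, hzr, hzs⟩ := halt hy
    (by rw [hr]; exact ⟨0, by rwa [truth_innerDepth_congr G V W]⟩)
    ⟨hrs y (hxy.mono (Nat.le_succ N)), fun z hz => hrs z (hxy.snoc (Or.inr (Or.inr hz)))⟩
    ⟨hsr y (hxy.mono (Nat.le_succ N)), fun z hz => hsr z (hxy.snoc (Or.inr (Or.inr hz)))⟩
  rw [hr] at hzr
  rw [hs] at hzs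
  obtain ⟨i, hi'⟩ := hzr
  obtain ⟨j, hj⟩ := hzs
  have := depthEq_unique G V ((mem_truth_innerDepth G V).1 hi').1
    ((mem_truth_innerDepth G V).1 hj).1
  omega

/-! ### Continuum many logics with the same frames. -/

theorem exists_injective_Fr_eq {L : Set Formula} (hL : L ∈ NExt K4t) (h : ¬ L ⊆ K4s) :
    ∃ f : Set ℕ → Set Formula, Function.Injective f ∧
      ∀ I, f I ∈ NExt K4t ∧ Fr.{u} (f I) = Fr.{u} L := by
  obtain ⟨φ, hφL, hφ⟩ := Set.not_subset.1 h
  obtain ⟨F, hfin, hF, hi, hFφ⟩ := exists_finite_countermodel_of_notMem_K4s.{0} hφ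
  simp only [Frame.Validates, not_forall] at hFφ
  obtain ⟨V, x, hx⟩ := hFφ
  let n := φ.depth
  obtain ⟨K, hK1, hK⟩ := exists_depth_bound F n
  -- Codes are shifted by `K` so that no base point has the depth of a coding spike.
  let S : Set ℕ → Set ℕ := fun I => (K + ·) '' I
  have hS : ∀ I k, K + k ∈ S I ↔ k ∈ I := fun I k =>
    (add_right_injective K).mem_set_image
  have key : ∀ I k, or φ (within (2 * n + 2) (initialDepth (K + k + 1))) ∈
      L ∩ towerLogic F n (S I) ↔ k ∈ I := by
    intro I k
    constructor
    · intro hmem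
      by_contra hk
      -- The countermodel on `F`, copied to every level and empty on the chain, hence admissible;
      -- `φ` fails at level `n`.
      let W : ℕ → Set (towerFrame F n (S I)).carrier :=
        fun m => {p | ∃ y ∈ V m, ∃ j, p = TowerPoint.base y j}
      have hW : ∀ m, W m ∈ towerSets F n (S I) := fun m => Or.inr (Eventually.of_forall (by
        rintro j ⟨y, -, i, hj⟩
        cases hj))
      rcases (mem_truth_or _ W).1 (hmem.2 W hW (.base x (Fin.last n))) with h | h
      · exact hx ((base_mem_truth_iff V φ x (Fin.last n) le_rfl).1 h)
      · obtain ⟨q, -, hq⟩ := (mem_truth_within _ W).1 h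
        exact not_mem_initialDepth (hK (S I)) hK1 (Nat.le_add_right K k)
          (fun h => hk ((hS I k).1 h)) W q hq
    · exact fun hk => or_mem_inter hL.1 (isTenseLogic_towerLogic F n (S I)) hφL
        (within_initialDepth_mem hi (by omega) ((hS I k).2 hk))
  refine ⟨fun I => L ∩ towerLogic F n (S I), fun I J hIJ => ?_, fun I => ⟨⟨hL.1.inter
    (isTenseLogic_towerLogic F n (S I)), Set.subset_inter hL.2 (K4t_subset_logicOf
    (tower_admissible F n (S I)) (towerFrame_trans F n (S I) hF))⟩,
    Fr_inter_towerLogic hi (hK (S I)) hK1 hL.1⟩⟩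
  ext k
  rw [← key I k, ← key J k]
  exact Set.ext_iff.1 hIJ _

/-! ### The dichotomy -/

theorem mk_setFormula_le : Cardinal.mk (Set Formula) ≤ 2 ^ Cardinal.aleph0.{0} := by
  have := countable_formula
  rw [Cardinal.mk_set]
  exact Cardinal.power_le_power_left two_ne_zero Cardinal.mk_le_aleph0

theorem deg_le_df (L : Set Formula) : deg.{u} K4t L ≤ df.{u} K4t L :=
  Cardinal.mk_le_mk_of_subset fun _ h => ⟨h.1, Fr_eq_imp_FinFr_eq h.2⟩

theorem df_le (L : Set Formula) : df.{u} K4t L ≤ 2 ^ Cardinal.aleph0.{0} :=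
  (Cardinal.mk_subtype_le _).trans mk_setFormula_le

theorem le_deg {L : Set Formula} (hL : L ∈ NExt K4t) (h : ¬ L ⊆ K4s) :
    2 ^ Cardinal.aleph0.{0} ≤ deg.{u} K4t L := by
  obtain ⟨f, hf, hf'⟩ := exists_injective_Fr_eq.{u} hL h
  rw [← Cardinal.mk_nat, ← Cardinal.mk_set]
  exact Cardinal.mk_le_of_injective (f := fun I => (⟨f I, hf' I⟩ :
    {L' : Set Formula // L' ∈ NExt K4t ∧ Fr.{u} L' = Fr.{u} L})) fun I J hIJ =>
      hf (congrArg Subtype.val hIJ)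

theorem one_le_deg {L : Set Formula} (hL : L ∈ NExt K4t) : 1 ≤ deg.{u} K4t L :=
  Cardinal.one_le_iff_ne_zero.2 (Cardinal.mk_ne_zero_iff.2 ⟨⟨L, hL, rfl⟩⟩)

theorem df_le_one {L : Set Formula} (hL : L ∈ NExt K4t) (h : L ⊆ K4s) : df.{u} K4t L ≤ 1 := by
  rw [df, Cardinal.le_one_iff_subsingleton]
  exact ⟨fun a b => Subtype.ext ((eq_of_FinFr_eq hL h a.2.1 a.2.2).trans
    (eq_of_FinFr_eq hL h b.2.1 b.2.2).symm)⟩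

end Tense

theorem mainTheorem8 (L : Set Tense.Formula) (hL : L ∈ Tense.NExt Tense.K4t) :
    Tense.deg.{u} Tense.K4t L = Tense.df.{u} Tense.K4t L ∧
      Tense.deg.{u} Tense.K4t L ∈ ({1, 2 ^ Cardinal.aleph0.{0}} : Set Cardinal.{0}) := by
  by_cases h : L ⊆ Tense.K4s
  · have h₁ : Tense.deg.{u} Tense.K4t L = 1 :=
      ((Tense.deg_le_df L).trans (Tense.df_le_one hL h)).antisymm (Tense.one_le_deg hL)
    have h₂ : Tense.df.{u} Tense.K4t L = 1 :=
      (Tense.df_le_one hL h).antisymm ((Tense.one_le_deg hL).trans (Tense.deg_le_df L))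
    exact ⟨h₁.trans h₂.symm, Or.inl h₁⟩
  · have h₁ : Tense.deg.{u} Tense.K4t L = 2 ^ Cardinal.aleph0.{0} :=
      ((Tense.deg_le_df L).trans (Tense.df_le L)).antisymm (Tense.le_deg hL h)
    have h₂ : Tense.df.{u} Tense.K4t L = 2 ^ Cardinal.aleph0.{0} :=
      (Tense.df_le L).antisymm ((Tense.le_deg hL h).trans (Tense.deg_le_df L))
    exact ⟨h₁.trans h₂.symm, Or.inr h₁⟩
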